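/- Let $k \ge 1$ be an integer and let $\alpha \in [1/2,1]$. Let $A_\alpha(x) = \left| \frac1x - \left\lfloor \frac1x - \alpha + 1 \right\rfloor \right|$ be the transformation of the $\alpha$-continued fractions, a map $(0,\alpha) \to [0,\alpha]$. For irrational $x \in \mathbb{R}$ put $x_0 = |x - \lfloor x - \alpha + 1\rfloor| \in (0,\alpha]$ (so $x_0 = x$ if $x \in (0,\alpha)$) and $x_{n} = A_\alpha^n(x_0)$ for $n \ge 0$, $\beta^{(\alpha)}_{-1}(x) = 1$ and $\beta^{(\alpha)}_{j}(x) = \prod_{i=0}^{j} x_i$ for $j \ge 0$. The $k$-Brjuno function is $$B_{k,\alpha}(x) = \sum_{n=0}^\infty \left(\beta^{(\alpha)}_{n-1}(x)\right)^k \log\left(\frac{1}{x_n}\right).$$ In other words, $B_{k,\alpha}$ is given by the series on $(0,\alpha)$ with $x_n = A_\alpha^n(x)$ and is extended to $\mathbb{R}$ by $\mathbb{Z}$-periodicity and $B_{k,\alpha}(-x) = B_{k,\alpha}(x)$ for $x \in (0,1-\alpha)$. Then the series converges for Lebesgue-almost every $x \in \mathbb{R}$, and $B_{k,\alpha}$,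 defined almost everywhere in this way, belongs to $\mathrm{BMO}(\mathbb{R})$: it is locally integrable on $\mathbb{R}$, and $$\sup_{I} \frac{1}{|I|}\int_I \left| B_{k,\alpha}(x) - \frac{1}{|I|}\int_I B_{k,\alpha}(y)\,dy \right| dx < \infty,$$ where the supremum is over all bounded intervals $I \subset \mathbb{R}$ of positive length. -/

import Mathlib

open MeasureTheory

noncomputable section

namespace KBrjuno

/-- The transformation `A_α(x) = |1/x - ⌊1/x - α + 1⌋|` of the `α`-continued fractions.
(For `1/2 ≤ α ≤ 1` it maps `0` to `0` with the convention `1/0 = 0`.) -/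
def alphaMap (α x : ℝ) : ℝ :=
  |1 / x - (⌊1 / x - α + 1⌋ : ℤ)|

/-- The representative `|x - ⌊x - α + 1⌋|` of `x` in `[0, α]`, `1/2 ≤ α ≤ 1`. A function on `(0, α)`
composed with it is the extension of that function that is `ℤ`-periodic on the line and satisfies
`f (-x) = f x` for `x` in `(0, 1 - α)`. -/
def alphaFold (α x : ℝ) : ℝ :=
  |x - (⌊x - α + 1⌋ : ℤ)|

/-- `A_α^n`, applied to the representative of `x` in `[0, α]`. -/
def orbit (α : ℝ) (n : ℕ) (x : ℝ) : ℝ :=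
  (alphaMap α)^[n] (alphaFold α x)

/-- `betaPrev α n` is `β_{n-1}^{(α)}`, the product of `A_α^i` over `0 ≤ i ≤ n - 1`;
in particular `betaPrev α 0 = β_{-1}^{(α)} = 1`. -/
def betaPrev (α : ℝ) (n : ℕ) (x : ℝ) : ℝ :=
  ∏ i ∈ Finset.range n, orbit α i x

/-- The `n`-th term of the series of the `k`-Brjuno function. -/
def brjunoTerm (k : ℕ) (α : ℝ) (n : ℕ) (x : ℝ) : ℝ :=
  betaPrev α n x ^ k * Real.log (1 / orbit α n x)

/-- The `k`-Brjuno function `B_{k,α}` on the real line (with the value `0` where the series,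
all of whose terms are nonnegative, diverges). -/
def brjuno (k : ℕ) (α : ℝ) (x : ℝ) : ℝ :=
  ∑' n : ℕ, brjunoTerm k α n x

/-- The mean oscillation `|I|⁻¹ ∫_I |f - f_I|` over the interval `I` with endpoints `a < b`,
where `f_I = |I|⁻¹ ∫_I f`. -/
def meanOsc (f : ℝ → ℝ) (a b : ℝ) : ℝ :=
  (1 / (b - a)) * ∫ x in a..b, |f x - (1 / (b - a)) * ∫ y in a..b, f y|

/-- The seminorm `‖f‖_{*,U}`: the supremum of the mean oscillations of `f` over the bounded
intervals of positive length contained in `U`. -/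
def bmoSeminorm (U : Set ℝ) (f : ℝ → ℝ) : ENNReal :=
  ⨆ (a : ℝ) (b : ℝ) (_ : a < b) (_ : Set.Ioo a b ⊆ U), ENNReal.ofReal (meanOsc f a b)

/-- `f ∈ BMO(U)`: `f` is locally integrable on the line and `‖f‖_{*,U}` is finite. -/
def MemBMO (U : Set ℝ) (f : ℝ → ℝ) : Prop :=
  LocallyIntegrable f volume ∧ bmoSeminorm U f < ⊤

end KBrjuno

end

/-!
The Brjuno function is compared with a sum of logarithmic bumps that does not involve `α`,
`F(x) = ∑ q ^ -k log⁺ (1 / (8 q² |x - p / q|))`, the sum being over all rationals `p / q` in lowest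
terms (`ratSum`).

*The difference `B - F` is bounded* (`summable_brjunoTerm_and_abs_sub_le`). Let `p_n / q_n` be the
convergents of the `α`-continued fraction of an irrational `x`. Then `|q_n x - p_n| = β_n`, and
`β_{n-1} q_n` is comparable to `1` with an error of order `x_n` (`exists_convergent`). As
`β_n = β_{n-1} x_n`, the bump of `p_n / q_n` at `x` is `q_n ^ -k log⁺ (1 / (8 q_n β_n))`, which agrees
with the term `β_{n-1} ^ k log (1 / x_n)` up to a multiple of `β_{n-1}`
(`abs_brjunoTerm_sub_ratTerm_le`). The other rationals do not contribute at `x`, because every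
rational with `8 q² |x - p / q| < 1` is a convergent (`exists_eq_convergent`). Finally
`β_{n+2} ≤ β_n / 2` for `α ∈ [1/2, 1]`, so `∑ β_{n-1} ≤ 4` for every irrational `x`.

*`F` has bounded mean oscillation.* Over an interval of length `L`, a bump of radius `δ` differs from
a suitable constant by at most `4 min (δ, L)` in `L¹`, and it does not contribute if it does not meet
the interval (`exists_lintegral_logBump_sub_le`). Rationals with denominators between `2 ^ j` and
`2 ^ (j + 1)` have radius of order `4 ^ -j` and are separated by `4 ^ -(j + 1)`, so `O(4 ^ j L + 1)` of
them count. With weights at most `2 ^ -j` they contribute `O(2 ^ -j L)`, and the sum over `j` is `O(L)`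
(`tsum_oscillation_le`). On long intervals the same estimate bounds the integral of `F`, which is
therefore finite almost everywhere; together with the comparison of the terms this also gives the
convergence of the Brjuno series.
-/

namespace KBrjuno

/-! ### Dynamics of the expansion -/

lemma orbit_zero (α x : ℝ) : orbit α 0 x = |x - (⌊x - α + 1⌋ : ℤ)| := rfl

lemma orbit_succ (α : ℝ) (n : ℕ) (x : ℝ) :
    orbit α (n + 1) x = |1 / orbit α n x - (⌊1 / orbit α n x - α + 1⌋ : ℤ)| := by
  simp only [orbit, Function.iterate_succ_apply']
  rfl

lemma betaPrev_zero (α x : ℝ) : betaPrev α 0 x = 1 := by simp [betaPrev]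

lemma betaPrev_succ (α : ℝ) (n : ℕ) (x : ℝ) :
    betaPrev α (n + 1) x = betaPrev α n x * orbit α n x := by
  simp [betaPrev, Finset.prod_range_succ]

lemma sub_floor_mem {α z : ℝ} :
    α - 1 ≤ z - (⌊z - α + 1⌋ : ℤ) ∧ z - (⌊z - α + 1⌋ : ℤ) < α := by
  constructor
  · linarith [Int.floor_le (z - α + 1)]
  · linarith [Int.lt_floor_add_one (z - α + 1)]

lemma orbit_mem {α : ℝ} (hα : α ∈ Set.Icc (1 / 2 : ℝ) 1) (n : ℕ) (x : ℝ) :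
    orbit α n x ∈ Set.Icc (0 : ℝ) 1 := by
  obtain ⟨h1, h2⟩ := hα
  have key : ∀ z : ℝ, |z - (⌊z - α + 1⌋ : ℤ)| ∈ Set.Icc (0 : ℝ) 1 := fun z => by
    have := @sub_floor_mem α z
    exact ⟨abs_nonneg _, abs_le.2 ⟨by linarith, by linarith⟩⟩
  cases n with
  | zero => rw [orbit_zero]; exact key x
  | succ n => rw [orbit_succ]; exact key _

lemma betaPrev_nonneg {α : ℝ} (hα : α ∈ Set.Icc (1 / 2 : ℝ) 1) (n : ℕ) (x : ℝ) :
    0 ≤ betaPrev α n x :=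
  Finset.prod_nonneg fun i _ => (orbit_mem hα i x).1

lemma betaPrev_le_one {α : ℝ} (hα : α ∈ Set.Icc (1 / 2 : ℝ) 1) (n : ℕ) (x : ℝ) :
    betaPrev α n x ≤ 1 :=
  Finset.prod_le_one (fun i _ => (orbit_mem hα i x).1) fun i _ => (orbit_mem hα i x).2

lemma irrational_abs {y : ℝ} (h : Irrational y) : Irrational |y| := by
  rcases abs_choice y with e | e <;> rw [e]
  · exact h
  · exact h.neg

/-- Two consecutive convergents `p' / q'` and `p / q` of the expansion of `x`, the second of which
has index `n`, together with the signed remainder `y = ± x_n`. For `n = 0` the first one is the formal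
fraction `1 / 0`. -/
structure IsConvergentPair (α x : ℝ) (n : ℕ) (p' q' p q : ℤ) (y : ℝ) : Prop where
  irrational : Irrational y
  le_y : α - 1 ≤ y
  y_lt : y < α
  abs_y : |y| = orbit α n x
  q'_nonneg : 0 ≤ q'
  q_pos : 0 < q
  q'_le_q : q' ≤ q
  next_error : q * x - p = -y * (q' * x - p')
  error : |q' * x - p'| = betaPrev α n x
  det : |p * q' - p' * q| = 1

/-- The recursion is `p_{n+1} = a p_n ± p_{n-1}`, `q_{n+1} = a q_n ± q_{n-1}`, where `a` is the digit
`⌊1 / x_n - α + 1⌋` and the sign is that of the signed remainder. -/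
lemma exists_isConvergentPair {α : ℝ} (hα : α ∈ Set.Icc (1 / 2 : ℝ) 1) {x : ℝ}
    (hx : Irrational x) (n : ℕ) : ∃ p' q' p q y, IsConvergentPair α x n p' q' p q y := by
  obtain ⟨h1, h2⟩ := hα
  induction n with
  | zero =>
    refine ⟨1, 0, ⌊x - α + 1⌋, 1, x - (⌊x - α + 1⌋ : ℤ), ?_⟩
    exact
      { irrational := hx.sub_intCast _
        le_y := sub_floor_mem.1
        y_lt := sub_floor_mem.2
        abs_y := by rw [orbit_zero]
        q'_nonneg := le_rfl
        q_pos := one_pos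
        q'_le_q := zero_le_one
        next_error := by push_cast; ring
        error := by simp [betaPrev_zero]
        det := by simp }
  | succ n ih =>
    obtain ⟨p', q', p, q, y, h⟩ := ih
    have hy0 : y ≠ 0 := h.irrational.ne_zero
    have hay : 0 < |y| := abs_pos.2 hy0
    obtain ⟨a, ha⟩ : ∃ a : ℤ, a = ⌊1 / |y| - α + 1⌋ := ⟨_, rfl⟩
    have hmem := @sub_floor_mem α (1 / |y|)
    rw [← ha] at hmem
    have herr : |q * x - p| = betaPrev α (n + 1) x := by
      rw [h.next_error, abs_mul, abs_neg, h.error, h.abs_y, betaPrev_succ, mul_comm]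
    have hirr : Irrational (1 / |y| - a) := by
      rw [one_div]
      exact (irrational_abs h.irrational).inv.sub_intCast a
    have hyx : orbit α (n + 1) x = |1 / |y| - a| := by rw [orbit_succ, ← h.abs_y, ← ha]
    have hq := h.q_pos
    have hq' := h.q'_nonneg
    have hqq := h.q'_le_q
    rcases lt_or_gt_of_ne hy0 with hneg | hpos
    · -- A negative remainder is at most `1 - α` in size, which forces the next digit up to `2`.
      have hyabs : |y| = -y := abs_of_neg hneg
      have hinv : 2 ≤ 1 / |y| := by
        rw [le_div_iff₀ hay, hyabs]; linarith [h.le_y]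
      have ha2 : 2 ≤ a := by
        rw [ha, Int.le_floor]; push_cast; linarith
      have hge : q ≤ a * q - q' := by nlinarith
      refine ⟨p, q, a * p - p', a * q - q', 1 / |y| - a, ?_⟩
      exact
        { irrational := hirr
          le_y := hmem.1
          y_lt := hmem.2
          abs_y := hyx.symm
          q'_nonneg := hq.le
          q_pos := by omega
          q'_le_q := hge
          next_error := by
            have e := h.next_error
            have : 1 / |y| * (q * x - p) = q' * x - p' := by
              rw [e, hyabs]; field_simp
            push_cast
            linear_combination this
          error := herr
          det := by
            have := h.det
            rw [← this, show (a * p - p') * q - p * (a * q - q') = p * q' - p' * q by ring] }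
    · have hyabs : |y| = y := abs_of_pos hpos
      have hinv : 1 ≤ 1 / |y| := by
        rw [le_div_iff₀ hay, hyabs]; linarith [h.y_lt]
      have ha1 : 1 ≤ a := by
        rw [ha, Int.le_floor]; push_cast; linarith
      have hge : q ≤ a * q + q' := by nlinarith
      refine ⟨p, q, a * p + p', a * q + q', 1 / |y| - a, ?_⟩
      exact
        { irrational := hirr
          le_y := hmem.1
          y_lt := hmem.2
          abs_y := hyx.symm
          q'_nonneg := hq.le
          q_pos := by omega
          q'_le_q := hge
          next_error := by
            have e := h.next_error
            have : 1 / |y| * (q * x - p) = -(q' * x - p') := by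
              rw [e, hyabs]; field_simp
            push_cast
            linear_combination this
          error := herr
          det := by
            have := h.det
            rw [← this, show (a * p + p') * q - p * (a * q + q') = -(p * q' - p' * q) by ring,
              abs_neg] }

lemma orbit_irrational {α : ℝ} (hα : α ∈ Set.Icc (1 / 2 : ℝ) 1) {x : ℝ}
    (hx : Irrational x) (n : ℕ) : Irrational (orbit α n x) := by
  obtain ⟨p', q', p, q, y, h⟩ := exists_isConvergentPair hα hx n
  rw [← h.abs_y]
  exact irrational_abs h.irrational

lemma orbit_pos {α : ℝ} (hα : α ∈ Set.Icc (1 / 2 : ℝ) 1) {x : ℝ}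
    (hx : Irrational x) (n : ℕ) : 0 < orbit α n x :=
  lt_of_le_of_ne (orbit_mem hα n x).1 (orbit_irrational hα hx n).ne_zero.symm

lemma betaPrev_pos {α : ℝ} (hα : α ∈ Set.Icc (1 / 2 : ℝ) 1) {x : ℝ}
    (hx : Irrational x) (n : ℕ) : 0 < betaPrev α n x :=
  Finset.prod_pos fun i _ => orbit_pos hα hx i

lemma betaPrev_strictAnti {α : ℝ} (hα : α ∈ Set.Icc (1 / 2 : ℝ) 1) {x : ℝ}
    (hx : Irrational x) : StrictAnti fun n => betaPrev α n x := by
  refine strictAnti_nat_of_succ_lt fun n => ?_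
  rw [betaPrev_succ]
  exact mul_lt_of_lt_one_right (betaPrev_pos hα hx n)
    (lt_of_le_of_ne (orbit_mem hα n x).2 (orbit_irrational hα hx n).ne_one)

/-- This yields the exponential decay of `β_n`, uniformly in `x`. -/
lemma orbit_mul_orbit_succ_le {α : ℝ} (hα : α ∈ Set.Icc (1 / 2 : ℝ) 1) {x : ℝ}
    (hx : Irrational x) (n : ℕ) : orbit α n x * orbit α (n + 1) x ≤ 1 / 2 := by
  have h0 := orbit_pos hα hx n
  have h1 := (orbit_mem hα n x).2
  rw [orbit_succ]
  set u := orbit α n x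
  obtain ⟨a, ha⟩ : ∃ a : ℤ, a = ⌊1 / u - α + 1⌋ := ⟨_, rfl⟩
  have hmem := @sub_floor_mem α (1 / u)
  rw [← ha] at hmem ⊢
  have hα1 := hα.1
  have hα2 := hα.2
  have hinv : 1 ≤ 1 / u := by rw [le_div_iff₀ h0]; linarith
  have ha1 : (1 : ℝ) ≤ a := by
    have : 1 ≤ a := by rw [ha, Int.le_floor]; push_cast; linarith
    exact_mod_cast this
  rcases le_total 0 (1 / u - a) with hs | hs
  · rw [abs_of_nonneg hs]
    -- The remainder is at most `1`, hence at most the digit `a`, so at most half of `1 / u`.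
    have : 1 / u - a ≤ 1 / u / 2 := by linarith
    calc u * (1 / u - a) ≤ u * (1 / u / 2) := by gcongr
      _ = 1 / 2 := by field_simp
  · rw [abs_of_nonpos hs]
    nlinarith

lemma two_mul_betaPrev_add_two_le {α : ℝ} (hα : α ∈ Set.Icc (1 / 2 : ℝ) 1) {x : ℝ}
    (hx : Irrational x) (n : ℕ) : 2 * betaPrev α (n + 2) x ≤ betaPrev α n x := by
  rw [betaPrev_succ, betaPrev_succ]
  nlinarith [orbit_mul_orbit_succ_le hα hx n, betaPrev_pos hα hx n]

/-- As `β_{n+2} ≤ β_n / 2`, the partial sums increased by `2 (β_{n-1} + β_n)` do not grow. -/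
lemma sum_betaPrev_le {α : ℝ} (hα : α ∈ Set.Icc (1 / 2 : ℝ) 1) {x : ℝ}
    (hx : Irrational x) (n : ℕ) : ∑ i ∈ Finset.range n, betaPrev α i x ≤ 4 := by
  have key : ∑ i ∈ Finset.range n, betaPrev α i x
      + 2 * (betaPrev α n x + betaPrev α (n + 1) x) ≤ 4 := by
    induction n with
    | zero =>
      have := betaPrev_le_one hα 1 x
      simp only [Finset.range_zero, Finset.sum_empty, betaPrev_zero, zero_add]
      linarith
    | succ n ih =>
      rw [Finset.sum_range_succ]
      linarith [two_mul_betaPrev_add_two_le hα hx n]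
  linarith [betaPrev_pos hα hx n, betaPrev_pos hα hx (n + 1)]

lemma summable_betaPrev {α : ℝ} (hα : α ∈ Set.Icc (1 / 2 : ℝ) 1) {x : ℝ}
    (hx : Irrational x) : Summable fun n => betaPrev α n x :=
  summable_of_sum_range_le (fun n => betaPrev_nonneg hα n x) (sum_betaPrev_le hα hx)

lemma tsum_betaPrev_le {α : ℝ} (hα : α ∈ Set.Icc (1 / 2 : ℝ) 1) {x : ℝ}
    (hx : Irrational x) : ∑' n, betaPrev α n x ≤ 4 :=
  Real.tsum_le_of_sum_range_le (fun n => betaPrev_nonneg hα n x) (sum_betaPrev_le hα hx)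

/-! ### Convergents as best approximations -/

/-- The `n`-th convergent as a rational number in lowest terms. The number `t` is
`1 / (β_{n-1} q_n)`; the estimates say that it is comparable to `1` and tends to `1` with `x_n`. -/
lemma exists_convergent {α : ℝ} (hα : α ∈ Set.Icc (1 / 2 : ℝ) 1) {x : ℝ}
    (hx : Irrational x) (n : ℕ) :
    ∃ r : ℚ, (r.den : ℝ) * |x - r| = betaPrev α (n + 1) x ∧
      ∃ t : ℝ, betaPrev α n x * r.den * t = 1 ∧ 1 / 2 ≤ t ∧ t ≤ 2 ∧ |t - 1| ≤ orbit α n x := by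
  obtain ⟨p', q', p, q, y, h⟩ := exists_isConvergentPair hα hx n
  have hq : (0 : ℝ) < q := by exact_mod_cast h.q_pos
  have hq' : (0 : ℝ) ≤ q' := by exact_mod_cast h.q'_nonneg
  have hqq : (q' : ℝ) ≤ q := by exact_mod_cast h.q'_le_q
  have hcop : IsCoprime p q := by
    rcases (abs_eq zero_le_one).1 h.det with e | e
    · exact ⟨q', -p', by linarith⟩
    · exact ⟨-q', p', by linarith⟩
  have hden : (((p : ℚ) / q).den : ℤ) = q :=
    Rat.den_div_eq_of_coprime h.q_pos (Int.isCoprime_iff_nat_coprime.1 hcop)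
  have hdenR : (((p : ℚ) / q).den : ℝ) = q := by exact_mod_cast congrArg (Int.cast (R := ℝ)) hden
  refine ⟨(p : ℚ) / q, ?_, 1 + q' / q * y, ?_, ?_, ?_, ?_⟩
  · have e : |(q : ℝ) * x - p| = betaPrev α (n + 1) x := by
      rw [h.next_error, abs_mul, abs_neg, h.error, h.abs_y, betaPrev_succ, mul_comm]
    rw [hdenR, ← e]
    push_cast
    nth_rewrite 1 [← abs_of_pos hq]
    rw [← abs_mul]
    congr 1
    field_simp
  · have hy : -(1 / 2) ≤ y := by linarith [h.le_y, hα.1]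
    have hpos : 0 < q + q' * y := by nlinarith
    have hdet : |((p : ℝ) * q' - p' * q)| = 1 := by exact_mod_cast congrArg (Int.cast (R := ℝ)) h.det
    have e : (p : ℝ) * q' - p' * q = (q' * x - p') * (q + q' * y) := by
      linear_combination (-(q' : ℝ)) * h.next_error
    rw [e, abs_mul, h.error, abs_of_pos hpos] at hdet
    rw [hdenR]
    refine Eq.trans ?_ hdet
    field_simp
  all_goals
    have hρ0 : 0 ≤ (q' : ℝ) / q := by positivity
    have hρ1 : (q' : ℝ) / q ≤ 1 := (div_le_one hq).2 hqq
    have hα1 := hα.1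
    have hα2 := hα.2
    have hy1 := h.le_y
    have hy2 := h.y_lt
  · nlinarith
  · nlinarith
  · rw [← h.abs_y, add_sub_cancel_left, abs_mul, abs_of_nonneg hρ0]
    exact mul_le_of_le_one_left (abs_nonneg y) hρ1

/-- Distinct rationals repel: the distance is at least the inverse product of denominators. -/
lemma one_le_den_mul_den_mul_abs_sub {r s : ℚ} (h : r ≠ s) :
    (1 : ℝ) ≤ r.den * s.den * |(r : ℝ) - s| := by
  have hr : (0 : ℝ) < r.den := by exact_mod_cast r.pos
  have hs : (0 : ℝ) < s.den := by exact_mod_cast s.pos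
  have e : (r.den : ℝ) * s.den * ((r : ℝ) - s) = ((r.num * s.den - s.num * r.den : ℤ) : ℝ) := by
    rw [Rat.cast_def r, Rat.cast_def s]
    push_cast
    field_simp
  rw [← abs_of_pos (mul_pos hr hs), ← abs_mul, e, ← Int.cast_abs]
  have : r.num * s.den - s.num * r.den ≠ 0 := fun h0 => h (Rat.eq_iff_mul_eq_mul.2 (by linarith))
  exact_mod_cast Int.one_le_abs this

/-- An analogue of Legendre's theorem: a rational `r` with `8 (den r)² |x - r| < 1` has to be a
convergent. -/
lemma exists_eq_convergent {α : ℝ} (hα : α ∈ Set.Icc (1 / 2 : ℝ) 1) {x : ℝ}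
    (hx : Irrational x) {c : ℕ → ℚ}
    (hc : ∀ n, (c n).den * |x - c n| = betaPrev α (n + 1) x)
    (hb : ∀ n, betaPrev α n x * (c n).den ≤ 2)
    {r : ℚ} (hr : |x - r| < 1 / (8 * (r.den : ℝ) ^ 2)) : ∃ n, c n = r := by
  have hq : (1 : ℝ) ≤ r.den := by exact_mod_cast r.pos
  have hlim := (summable_betaPrev hα hx).tendsto_atTop_zero
  have hex : ∃ n, r.den * betaPrev α (n + 1) x ≤ 1 / 2 := by
    have h0 : (0 : ℝ) < 1 / (2 * r.den) := by positivity
    obtain ⟨N, hN⟩ := (hlim.eventually (gt_mem_nhds h0)).exists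
    refine ⟨N, ?_⟩
    have h3 : betaPrev α (N + 1) x < 1 / (2 * r.den) :=
      ((betaPrev_strictAnti hα hx) N.lt_succ_self).trans hN
    rw [lt_div_iff₀ (by positivity)] at h3
    linarith
  classical
  -- The index `n` is chosen so that `1 / (2 β_{n-1}) < den r ≤ 1 / (2 β_n)`.
  obtain ⟨n, hn, hmin⟩ : ∃ n, r.den * betaPrev α (n + 1) x ≤ 1 / 2 ∧
      1 / 2 < r.den * betaPrev α n x := by
    refine ⟨Nat.find hex, Nat.find_spec hex, ?_⟩
    rcases Nat.eq_zero_or_pos (Nat.find hex) with h | h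
    · rw [h, betaPrev_zero]; linarith
    · obtain ⟨m, hm⟩ := Nat.exists_eq_succ_of_ne_zero h.ne'
      rw [hm]
      exact not_le.1 (Nat.find_min hex (m := m) (by omega))
  refine ⟨n, ?_⟩
  by_contra hne
  have hcn : (0 : ℝ) < (c n).den := by exact_mod_cast (c n).pos
  have h1 := one_le_den_mul_den_mul_abs_sub hne
  have htri : |(c n : ℝ) - r| ≤ |x - c n| + |x - r| := by
    rw [abs_sub_comm x (c n)]; exact abs_sub_le _ _ _
  have h2 : (1 : ℝ) ≤ r.den * betaPrev α (n + 1) x + (c n).den * r.den * |x - r| := by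
    rw [← hc n]
    calc (1 : ℝ) ≤ _ := h1
      _ ≤ (c n).den * r.den * (|x - c n| + |x - r|) := by gcongr
      _ = _ := by ring
  have h3 : r.den ^ 2 * |x - r| < 1 / 8 := by
    rw [lt_div_iff₀ (by positivity)] at hr
    linarith
  have h4 := hb n
  have hb0 := betaPrev_pos hα hx n
  -- The product of `den r * β_{n-1} > 1 / 2` and `den (c n) * den r * |x - r| ≥ 1 / 2` would be at
  -- least `1 / 4`; rearranged, it is `β_{n-1} * den (c n) ≤ 2` times `(den r)² |x - r| < 1 / 8`.
  have h5 : (1 : ℝ) / 2 ≤ (c n).den * r.den * |x - r| := by linarith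
  have h6 : r.den * betaPrev α n x * (1 / 2) ≤
      r.den * betaPrev α n x * ((c n).den * r.den * |x - r|) := by gcongr
  have h7 : r.den * betaPrev α n x * ((c n).den * r.den * |x - r|)
      = betaPrev α n x * (c n).den * (r.den ^ 2 * |x - r|) := by ring
  have h8 : betaPrev α n x * (c n).den * (r.den ^ 2 * |x - r|) ≤ 2 * (r.den ^ 2 * |x - r|) := by
    gcongr
  linarith

/-! ### Logarithmic bumps -/

/-- The positive part of `log (δ / |x - s|)`, a bump of radius `δ` around `s`. The value of the
logarithm at `0` only affects the point `x = s`. -/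
noncomputable def logBump (δ s x : ℝ) : ℝ := max 0 (Real.log δ - Real.log (x - s))

lemma logBump_eq_zero {δ s x : ℝ} (hδ : 0 < δ) (h : δ ≤ |x - s|) : logBump δ s x = 0 := by
  refine max_eq_left ?_
  rw [← Real.log_abs (x - s)]
  linarith [Real.log_le_log hδ h]

lemma measurable_logBump (δ s : ℝ) : Measurable (logBump δ s) := by
  unfold logBump
  fun_prop

/-- The logarithm has bounded mean oscillation: it is compared with its largest value on the
interval, and the integral of the difference is read off from the antiderivative. -/
lemma log_max_integral_le {a b : ℝ} (hab : a < b) :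
    ∫ x in a..b, (Real.log (max |a| |b|) - Real.log x) ≤ 2 * (b - a) := by
  rw [intervalIntegral.integral_sub (by simp) intervalIntegral.intervalIntegrable_log',
    intervalIntegral.integral_const, integral_log, smul_eq_mul]
  set M := max |a| |b|
  have hM : 0 < M := by
    by_contra h
    have h1 : |a| ≤ 0 := (le_max_left _ _).trans (not_lt.1 h)
    have h2 : |b| ≤ 0 := (le_max_right _ _).trans (not_lt.1 h)
    rw [abs_nonpos_iff.1 h1, abs_nonpos_iff.1 h2] at hab
    exact lt_irrefl _ hab
  have key : ∀ c : ℝ, |c| ≤ M → |c * (Real.log M - Real.log c)| ≤ M - |c| := fun c hc => by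
    rcases eq_or_ne c 0 with rfl | h0
    · simpa using hM.le
    · have hc0 : 0 < |c| := abs_pos.2 h0
      have hl : 0 ≤ Real.log M - Real.log c := by
        rw [← Real.log_abs c]; linarith [Real.log_le_log hc0 hc]
      rw [abs_mul, abs_of_nonneg hl, ← Real.log_abs c, ← Real.log_div hM.ne' hc0.ne']
      calc |c| * Real.log (M / |c|) ≤ |c| * (M / |c| - 1) := by
            gcongr; exact Real.log_le_sub_one_of_pos (by positivity)
        _ = M - |c| := by field_simp
  have ha := (abs_le.1 (key a (le_max_left _ _))).1
  have hb := (abs_le.1 (key b (le_max_right _ _))).2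
  have hsum : (M - |a|) + (M - |b|) ≤ b - a := by
    have e1 : |b| - |a| ≤ b - a := (abs_sub_abs_le_abs_sub b a).trans_eq (abs_of_pos (by linarith))
    have e2 : |a| - |b| ≤ b - a := by
      rw [← abs_of_pos (sub_pos.2 hab), abs_sub_comm]; exact abs_sub_abs_le_abs_sub a b
    rcases max_cases |a| |b| with ⟨e, _⟩ | ⟨e, _⟩ <;> simp only [M, e] <;> linarith
  nlinarith

lemma lintegral_log_sub_le (s : ℝ) {a b : ℝ} (hab : a < b) :
    ∫⁻ x in Set.Ioc a b, ‖Real.log (x - s) - Real.log (max |a - s| |b - s|)‖ₑ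
      ≤ ENNReal.ofReal (2 * (b - a)) := by
  set M := max |a - s| |b - s|
  have hae : ∀ᵐ x ∂volume.restrict (Set.Ioc a b), 0 ≤ Real.log M - Real.log (x - s) := by
    filter_upwards [ae_restrict_mem measurableSet_Ioc, Measure.ae_ne _ s] with x hx hne
    have h0 : 0 < |x - s| := abs_pos.2 (sub_ne_zero.2 hne)
    have h1 : |x - s| ≤ M := by
      refine abs_le_max_abs_abs ?_ ?_ <;> linarith [hx.1, hx.2]
    rw [← Real.log_abs (x - s)]
    linarith [Real.log_le_log h0 h1]
  have hint : IntervalIntegrable (fun x => Real.log M - Real.log (x - s)) volume a b := by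
    refine IntervalIntegrable.sub (by simp) ?_
    simpa using (intervalIntegral.intervalIntegrable_log' (a := a - s) (b := b - s)).comp_sub_right s
  rw [intervalIntegrable_iff_integrableOn_Ioc_of_le hab.le] at hint
  calc ∫⁻ x in Set.Ioc a b, ‖Real.log (x - s) - Real.log M‖ₑ
      = ∫⁻ x in Set.Ioc a b, ENNReal.ofReal (Real.log M - Real.log (x - s)) := by
        refine lintegral_congr_ae ?_
        filter_upwards [hae] with x hx
        rw [enorm_sub_rev, Real.enorm_eq_ofReal hx]
    _ = ENNReal.ofReal (∫ x in a..b, (Real.log M - Real.log (x - s))) := by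
        rw [intervalIntegral.integral_of_le hab.le, ofReal_integral_eq_lintegral_ofReal hint hae]
    _ ≤ ENNReal.ofReal (2 * (b - a)) := by
        refine ENNReal.ofReal_le_ofReal ?_
        rw [intervalIntegral.integral_comp_sub_right (fun x => Real.log M - Real.log x)]
        exact (log_max_integral_le (by linarith)).trans_eq (by ring)

/-- Truncation is `1`-Lipschitz, so bumps of every radius inherit the oscillation bound. -/
lemma lintegral_logBump_sub_le (δ s : ℝ) {a b : ℝ} (hab : a < b) :
    ∫⁻ x in Set.Ioc a b, ‖logBump δ s x - max 0 (Real.log δ - Real.log (max |a - s| |b - s|))‖ₑ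
      ≤ ENNReal.ofReal (2 * (b - a)) := by
  refine le_trans (lintegral_mono fun x => ?_) (lintegral_log_sub_le s hab)
  rw [enorm_le_iff_norm_le, Real.norm_eq_abs, Real.norm_eq_abs, logBump]
  refine (abs_max_sub_max_le_max _ _ _ _).trans ?_
  rw [sub_self, abs_zero, max_eq_right (abs_nonneg _), ← abs_neg]
  exact (congrArg abs (by ring)).le

lemma lintegral_logBump_le {δ : ℝ} (hδ : 0 < δ) (s : ℝ) :
    ∫⁻ x, ‖logBump δ s x‖ₑ ≤ ENNReal.ofReal (4 * δ) := by
  have h := lintegral_logBump_sub_le δ s (a := s - δ) (b := s + δ) (by linarith)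
  have e : max |s - δ - s| |s + δ - s| = δ := by
    rw [show s - δ - s = -δ by ring, add_sub_cancel_left, abs_neg, max_self, abs_of_pos hδ]
  simp only [e, sub_self, max_self, sub_zero] at h
  rw [show 4 * δ = 2 * (s + δ - (s - δ)) by ring]
  refine le_trans (le_of_eq ?_) h
  rw [← lintegral_indicator measurableSet_Ioc]
  refine lintegral_congr_ae ?_
  filter_upwards with x
  by_cases hx : x ∈ Set.Ioc (s - δ) (s + δ)
  · rw [Set.indicator_of_mem hx]
  · rw [Set.indicator_of_notMem hx, logBump_eq_zero hδ, enorm_zero]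
    by_contra hlt
    have := abs_lt.1 (not_le.1 hlt)
    exact hx ⟨by linarith, by linarith⟩

/-- The oscillation of a bump over an interval `(a, b]` is at most `4 min (δ, b - a)`, and it
vanishes if the bump does not meet the interval. For short bumps the constant is `0`, so that the
bound is one for the integral of the bump itself. -/
lemma exists_lintegral_logBump_sub_le {δ : ℝ} (hδ : 0 < δ) (s : ℝ) {a b : ℝ} (hab : a < b) :
    ∃ m : ℝ, (δ ≤ b - a → m = 0) ∧ ∫⁻ x in Set.Ioc a b, ‖logBump δ s x - m‖ₑ
      ≤ if a - δ ≤ s ∧ s ≤ b + δ then ENNReal.ofReal (4 * min δ (b - a)) else 0 := by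
  split_ifs with hm
  · rcases le_or_gt δ (b - a) with h | h
    · refine ⟨0, fun _ => rfl, ?_⟩
      rw [min_eq_left h]
      simp only [sub_zero]
      exact (setLIntegral_le_lintegral _ _).trans (lintegral_logBump_le hδ s)
    · refine ⟨_, fun h' => absurd h' h.not_ge, (lintegral_logBump_sub_le δ s hab).trans
        (ENNReal.ofReal_le_ofReal ?_)⟩
      rw [min_eq_right h.le]
      linarith
  · refine ⟨0, fun _ => rfl, le_of_eq ?_⟩
    rw [setLIntegral_congr_fun (g := fun _ => 0) measurableSet_Ioc, lintegral_zero]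
    intro x hx
    dsimp only
    rw [logBump_eq_zero hδ, sub_zero, enorm_zero]
    by_contra hlt
    have := abs_lt.1 (not_le.1 hlt)
    exact hm ⟨by linarith [hx.1], by linarith [hx.2]⟩

/-! ### Counting rationals in an interval -/

/-- The radius `1 / (8 q²)` attached to a rational of denominator `q`. -/
noncomputable def radius (r : ℚ) : ℝ := 1 / (8 * (r.den : ℝ) ^ 2)

lemma radius_pos (r : ℚ) : 0 < radius r := by
  have : (0 : ℝ) < r.den := by exact_mod_cast r.pos
  unfold radius
  positivity

/-- Rationals of denominator less than `Q` are more than `Q⁻²` apart, which bounds their number in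
an interval. -/
lemma encard_rat_le {Q : ℝ} {c d : ℝ} (hcd : c ≤ d) :
    (({r : ℚ | (r.den : ℝ) < Q ∧ c ≤ r ∧ r ≤ d}.encard : ENNReal)) ≤
      ENNReal.ofReal (Q ^ 2 * (d - c) + 1) := by
  set S := {r : ℚ | (r.den : ℝ) < Q ∧ c ≤ r ∧ r ≤ d}
  have hnn : 0 ≤ Q ^ 2 * (d - c) := mul_nonneg (sq_nonneg _) (sub_nonneg.2 hcd)
  have hmaps : Set.MapsTo (fun r : ℚ => ⌊Q ^ 2 * ((r : ℝ) - c)⌋₊) S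
      (Finset.range (⌊Q ^ 2 * (d - c)⌋₊ + 1)) := by
    intro r hr
    simp only [Finset.coe_range, Set.mem_Iio, Nat.lt_succ_iff]
    exact Nat.floor_le_floor (mul_le_mul_of_nonneg_left (by linarith [hr.2.2]) (sq_nonneg Q))
  have hinj : Set.InjOn (fun r : ℚ => ⌊Q ^ 2 * ((r : ℝ) - c)⌋₊) S := by
    intro r hr s hs hrs
    by_contra hne
    have h1 := one_le_den_mul_den_mul_abs_sub hne
    have hQ : (r.den : ℝ) * s.den ≤ Q ^ 2 := by
      rw [sq]
      exact mul_le_mul hr.1.le hs.1.le (by positivity) ((Nat.cast_nonneg _).trans hr.1.le)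
    have h2 : 1 ≤ Q ^ 2 * |(r : ℝ) - s| :=
      h1.trans (mul_le_mul_of_nonneg_right hQ (abs_nonneg _))
    have h3 := Nat.floor_le (mul_nonneg (sq_nonneg Q) (sub_nonneg.2 hr.2.1))
    have h4 := Nat.floor_le (mul_nonneg (sq_nonneg Q) (sub_nonneg.2 hs.2.1))
    have h5 := Nat.lt_floor_add_one (Q ^ 2 * ((r : ℝ) - c))
    have h6 := Nat.lt_floor_add_one (Q ^ 2 * ((s : ℝ) - c))
    simp only at hrs
    rw [hrs] at h3 h5
    rcases abs_choice ((r : ℝ) - s) with e | e <;> rw [e] at h2 <;> nlinarith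
  have hcard := Set.encard_le_encard_of_injOn hmaps hinj
  rw [Set.encard_coe_eq_coe_finsetCard, Finset.card_range] at hcard
  calc (S.encard : ENNReal) ≤ (((⌊Q ^ 2 * (d - c)⌋₊ + 1 : ℕ) : ℕ∞) : ENNReal) := by
        exact_mod_cast hcard
    _ = ENNReal.ofReal ((⌊Q ^ 2 * (d - c)⌋₊ + 1 : ℕ) : ℝ) := by
        rw [ENNReal.ofReal_natCast]; rfl
    _ ≤ _ := by
        refine ENNReal.ofReal_le_ofReal ?_
        push_cast
        linarith [Nat.floor_le hnn]

/-- The contributions of all rationals to the oscillation over an interval. The rationals are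
grouped by the size `2 ^ j ≤ den r < 2 ^ (j + 1)` of the denominator; since two of them in the same
group are at least `4 ^ -(j + 1)` apart, each group contributes a multiple of `2 ^ -j`. -/
lemma tsum_oscillation_le {a b : ℝ} (hab : a < b) :
    ∑' r : ℚ, ENNReal.ofReal (1 / r.den) *
      (if a - radius r ≤ r ∧ (r : ℝ) ≤ b + radius r then
        ENNReal.ofReal (4 * min (radius r) (b - a)) else 0)
      ≤ ENNReal.ofReal (20 * (b - a)) := by
  set L := b - a with hL
  have hL0 : 0 < L := sub_pos.2 hab
  let ρ : ℕ → ℝ := fun j => 1 / (8 * (2 ^ j) ^ 2)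
  have hρ : ∀ j, 0 < ρ j := fun j => by positivity
  let S : ℕ → Set ℚ := fun j => {r | (r.den : ℝ) < 2 ^ (j + 1) ∧ a - ρ j ≤ r ∧ (r : ℝ) ≤ b + ρ j}
  let C : ℕ → ENNReal := fun j => ENNReal.ofReal (1 / 2 ^ j * (4 * min (ρ j) L))
  have hterm : ∀ r : ℚ, ENNReal.ofReal (1 / r.den) *
      (if a - radius r ≤ r ∧ (r : ℝ) ≤ b + radius r then
        ENNReal.ofReal (4 * min (radius r) L) else 0)
      ≤ ∑' j, (S j).indicator (fun _ => C j) r := by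
    intro r
    split_ifs with hm
    swap
    · simp
    refine le_trans ?_ (ENNReal.le_tsum (Nat.log 2 r.den))
    have hlo : (2 : ℝ) ^ Nat.log 2 r.den ≤ r.den := by
      exact_mod_cast Nat.pow_log_le_self 2 r.den_nz
    have hhi : (r.den : ℝ) < 2 ^ (Nat.log 2 r.den + 1) := by
      exact_mod_cast Nat.lt_pow_succ_log_self one_lt_two r.den
    have hrad : radius r ≤ ρ (Nat.log 2 r.den) := by
      simp only [radius, ρ]; gcongr
    rw [Set.indicator_of_mem (show r ∈ S (Nat.log 2 r.den) from
      ⟨hhi, by linarith [hm.1], by linarith [hm.2]⟩), ← ENNReal.ofReal_mul (by positivity)]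
    refine ENNReal.ofReal_le_ofReal ?_
    have := radius_pos r
    gcongr
  have hgroup : ∀ j, ∑' r, (S j).indicator (fun _ => C j) r ≤
      ENNReal.ofReal (10 * L * (1 / 2) ^ j) := by
    intro j
    rw [← tsum_subtype, ENNReal.tsum_set_const]
    refine (mul_le_mul_left (encard_rat_le (by linarith [hρ j])) _).trans ?_
    have hpos : (0 : ℝ) < 2 ^ j := by positivity
    have hmin0 : 0 < min (ρ j) L := lt_min (hρ j) hL0
    rw [← ENNReal.ofReal_mul]
    · refine ENNReal.ofReal_le_ofReal ?_
      have e1 : (2 ^ (j + 1)) ^ 2 * (b + ρ j - (a - ρ j)) + 1 = 4 * (2 ^ j) ^ 2 * L + 2 := by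
        have : (2 ^ j) ^ 2 * ρ j = 1 / 8 := by simp only [ρ]; field_simp
        rw [pow_succ, hL]
        linear_combination 8 * this
      rw [e1, one_div_pow]
      -- The group has at most `4 · 4 ^ j L + 2` members. The radius controls the contribution of the
      -- first summand, the length `L` that of the second one.
      have e2 : (2 ^ j) ^ 2 * L * min (ρ j) L ≤ 1 / 8 * L := by
        calc (2 ^ j) ^ 2 * L * min (ρ j) L ≤ (2 ^ j) ^ 2 * L * ρ j := by
              gcongr; exact min_le_left _ _
          _ = 1 / 8 * L := by simp only [ρ]; field_simp
      have e3 : min (ρ j) L ≤ L := min_le_right _ _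
      calc (4 * (2 ^ j) ^ 2 * L + 2) * (1 / 2 ^ j * (4 * min (ρ j) L))
          = (16 * ((2 ^ j) ^ 2 * L * min (ρ j) L) + 8 * min (ρ j) L) * (1 / 2 ^ j) := by ring
        _ ≤ (10 * L) * (1 / 2 ^ j) := by
            gcongr
            linarith
    · have := hρ j
      have h2 : 0 < b + ρ j - (a - ρ j) := by linarith
      positivity
  calc _ ≤ ∑' r : ℚ, ∑' j, (S j).indicator (fun _ => C j) r := ENNReal.tsum_le_tsum hterm
    _ = ∑' j, ∑' r : ℚ, (S j).indicator (fun _ => C j) r := ENNReal.tsum_comm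
    _ ≤ ∑' j, ENNReal.ofReal (10 * L * (1 / 2) ^ j) := ENNReal.tsum_le_tsum hgroup
    _ = ENNReal.ofReal (20 * L) := by
        have hs : Summable fun j : ℕ => 10 * L * (1 / 2 : ℝ) ^ j :=
          summable_geometric_two.mul_left _
        rw [← ENNReal.ofReal_tsum_of_nonneg (fun j => by positivity) hs, tsum_mul_left,
          tsum_geometric_two]
        congr 1; ring

/-! ### The arithmetic model of the Brjuno function -/

/-- The contribution of the rational `r` of denominator `q`: `q ^ -k` times the logarithmic bump of
radius `1 / (8 q²)` around `r`. -/
noncomputable def ratTerm (k : ℕ) (r : ℚ) (x : ℝ) : ℝ :=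
  (1 / (r.den : ℝ)) ^ k * logBump (radius r) r x

/-- The sum of logarithmic bumps over all rationals. It does not involve `α`. -/
noncomputable def ratSum (k : ℕ) (x : ℝ) : ℝ := ∑' r : ℚ, ratTerm k r x

lemma weight_le {k : ℕ} (hk : 1 ≤ k) (r : ℚ) : (1 / (r.den : ℝ)) ^ k ≤ 1 / r.den := by
  have h : (1 : ℝ) ≤ r.den := by exact_mod_cast r.pos
  exact pow_le_of_le_one (by positivity) ((div_le_one (by linarith)).2 h) (by omega)

lemma summable_of_tsum_enorm_lt_top {f : ℚ → ℝ} (h : ∑' r, ‖f r‖ₑ < ⊤) : Summable f :=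
  Summable.of_nnnorm (ENNReal.tsum_coe_ne_top_iff_summable.1 h.ne)

/-- The oscillation of the sum of bumps is estimated term by term. On intervals of length at least
`1` all the constants vanish, so that the estimate is one for the sum of the integrals. -/
lemma exists_lintegral_tsum_le {k : ℕ} (hk : 1 ≤ k) {a b : ℝ} (hab : a < b) :
    ∃ m : ℚ → ℝ, (1 ≤ b - a → ∀ r, m r = 0) ∧
      ∫⁻ x in Set.Ioc a b, ∑' r : ℚ, ‖ratTerm k r x - (1 / (r.den : ℝ)) ^ k * m r‖ₑ
        ≤ ENNReal.ofReal (20 * (b - a)) := by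
  choose m hm0 hm using fun r : ℚ => exists_lintegral_logBump_sub_le (radius_pos r) (r : ℝ) hab
  refine ⟨m, fun h r => hm0 r (le_trans ?_ h), ?_⟩
  · have h : (1 : ℝ) ≤ r.den := by exact_mod_cast r.pos
    unfold radius
    rw [div_le_one (by positivity)]
    nlinarith
  rw [lintegral_tsum fun r => ?_]
  · refine le_trans (ENNReal.tsum_le_tsum fun r => ?_) (tsum_oscillation_le hab)
    calc ∫⁻ x in Set.Ioc a b, ‖ratTerm k r x - (1 / (r.den : ℝ)) ^ k * m r‖ₑ
        = ENNReal.ofReal ((1 / (r.den : ℝ)) ^ k) *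
            ∫⁻ x in Set.Ioc a b, ‖logBump (radius r) r x - m r‖ₑ := by
          rw [← lintegral_const_mul' _ _ ENNReal.ofReal_ne_top]
          refine lintegral_congr fun x => ?_
          rw [ratTerm, ← mul_sub, enorm_mul, Real.enorm_eq_ofReal (by positivity)]
      _ ≤ _ := mul_le_mul' (ENNReal.ofReal_le_ofReal (weight_le hk r)) (hm r)
  · have := measurable_logBump (radius r) r
    unfold ratTerm
    fun_prop

lemma ae_summable_ratTerm {k : ℕ} (hk : 1 ≤ k) :
    ∀ᵐ x : ℝ, Summable fun r : ℚ => ratTerm k r x := by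
  have h : ∀ N : ℕ, ∀ᵐ x : ℝ, x ∈ Set.Ioc (-(N + 1) : ℝ) (N + 1) →
      Summable fun r : ℚ => ratTerm k r x := by
    intro N
    rw [← ae_restrict_iff' measurableSet_Ioc]
    have hN : (0 : ℝ) ≤ N := N.cast_nonneg
    obtain ⟨m, hm0, hm⟩ := exists_lintegral_tsum_le hk (a := -(N + 1)) (b := N + 1) (by linarith)
    simp only [hm0 (by linarith), mul_zero, sub_zero] at hm
    have hmeas : Measurable fun x => ∑' r : ℚ, ‖ratTerm k r x‖ₑ := by
      refine Measurable.tsum fun r => ?_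
      have := measurable_logBump (radius r) r
      unfold ratTerm
      fun_prop
    filter_upwards [ae_lt_top hmeas (hm.trans_lt ENNReal.ofReal_lt_top).ne] with x hx
    exact summable_of_tsum_enorm_lt_top hx
  filter_upwards [ae_all_iff.2 h] with x hx
  obtain ⟨N, hN⟩ := exists_nat_ge |x|
  have := abs_le.1 hN
  exact hx N ⟨by linarith, by linarith⟩

lemma exists_lintegral_ratSum_sub_le {k : ℕ} (hk : 1 ≤ k) {a b : ℝ} (hab : a < b) :
    ∃ c : ℝ, ∫⁻ x in Set.Ioc a b, ‖ratSum k x - c‖ₑ ≤ ENNReal.ofReal (20 * (b - a)) := by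
  obtain ⟨m, -, hm⟩ := exists_lintegral_tsum_le hk hab
  have hmeas : Measurable fun x => ∑' r : ℚ, ‖ratTerm k r x - (1 / (r.den : ℝ)) ^ k * m r‖ₑ := by
    refine Measurable.tsum fun r => ?_
    have := measurable_logBump (radius r) r
    unfold ratTerm
    fun_prop
  have h1 := ae_lt_top hmeas (hm.trans_lt ENNReal.ofReal_lt_top).ne
  have h2 := ae_restrict_of_ae (s := Set.Ioc a b) (ae_summable_ratTerm hk)
  -- The constants are summable because at almost every point of the interval both the bumps and
  -- their deviations from the constants are.
  have hne : Filter.NeBot (ae (volume.restrict (Set.Ioc a b))) := by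
    rw [ae_neBot, Ne, Measure.restrict_eq_zero, Real.volume_Ioc, ENNReal.ofReal_eq_zero]
    linarith
  have hsum : Summable fun r : ℚ => (1 / (r.den : ℝ)) ^ k * m r := by
    obtain ⟨x, hx1, hx2⟩ := (h1.and h2).exists
    simpa using hx2.sub (summable_of_tsum_enorm_lt_top hx1)
  refine ⟨∑' r : ℚ, (1 / (r.den : ℝ)) ^ k * m r, le_trans (lintegral_mono_ae ?_) hm⟩
  filter_upwards [h2] with x hx
  rw [ratSum, ← hx.tsum_sub hsum]
  exact enorm_tsum_le_tsum_enorm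

/-! ### Comparison of the Brjuno function with its model -/

/-- A bound for the ratio of the `n`-th difference between the two series and `β_{n-1}`. -/
noncomputable def termConst (k : ℕ) : ℝ := k * 2 ^ k + 2 ^ k * Real.log 16

lemma log_one_div_orbit_nonneg {α : ℝ} (hα : α ∈ Set.Icc (1 / 2 : ℝ) 1) (n : ℕ) (x : ℝ) :
    0 ≤ Real.log (1 / orbit α n x) := by
  rw [one_div, Real.log_inv, neg_nonneg]
  exact Real.log_nonpos (orbit_mem hα n x).1 (orbit_mem hα n x).2

lemma abs_brjunoTerm_sub_ratTerm_le {k : ℕ} (hk : 1 ≤ k) {α : ℝ}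
    (hα : α ∈ Set.Icc (1 / 2 : ℝ) 1) {x : ℝ} (hx : Irrational x) (n : ℕ) {r : ℚ}
    (hr : (r.den : ℝ) * |x - r| = betaPrev α (n + 1) x) {t : ℝ}
    (ht : betaPrev α n x * r.den * t = 1) (ht1 : 1 / 2 ≤ t) (ht2 : t ≤ 2)
    (ht3 : |t - 1| ≤ orbit α n x) :
    |brjunoTerm k α n x - ratTerm k r x| ≤ termConst k * betaPrev α n x := by
  have hβ := betaPrev_pos hα hx n
  have hβ1 := betaPrev_le_one hα n x
  have hu := orbit_pos hα hx n
  have hlam := log_one_div_orbit_nonneg hα n x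
  rw [betaPrev_succ] at hr
  unfold brjunoTerm ratTerm termConst
  set β := betaPrev α n x
  set u := orbit α n x
  set lam := Real.log (1 / u) with hlamdef
  have hq : (0 : ℝ) < r.den := by exact_mod_cast r.pos
  have ht0 : 0 < t := by linarith
  have hqinv : 1 / (r.den : ℝ) = β * t := by
    rw [div_eq_iff hq.ne']; linarith
  have hxr : 0 < |x - r| := abs_pos.2 (sub_ne_zero.2 (hx.ne_rat r))
  -- The bump at the convergent is `log (1 / x_n)` up to a bounded error.
  have hell : logBump (radius r) r x = max 0 (lam + Real.log t - Real.log 8) := by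
    rw [logBump, ← Real.log_abs (x - r), ← Real.log_div (radius_pos r).ne' hxr.ne', hlamdef,
      ← Real.log_mul (by positivity) ht0.ne', ← Real.log_div (by positivity) (by norm_num)]
    congr 2
    have hxr' : |x - r| = β * u / r.den := by rw [eq_div_iff hq.ne']; linarith
    rw [hxr', radius]
    field_simp
    linarith
  have hlogt1 : Real.log t ≤ Real.log 2 := Real.log_le_log ht0 ht2
  have hlogt2 : -Real.log 2 ≤ Real.log t := by
    rw [← Real.log_inv]; exact Real.log_le_log (by norm_num) (by linarith)
  have hlog8 : Real.log 8 = 3 * Real.log 2 := by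
    rw [show (8 : ℝ) = 2 ^ 3 by norm_num, Real.log_pow]; norm_num
  have hlog16 : Real.log 16 = 4 * Real.log 2 := by
    rw [show (16 : ℝ) = 2 ^ 4 by norm_num, Real.log_pow]; norm_num
  have hlog2 : 0 < Real.log 2 := Real.log_pos one_lt_two
  set ell := logBump (radius r) r x
  have hell1 : ell ≤ lam := by
    rw [hell]; exact max_le hlam (by linarith)
  have hell2 : lam - Real.log 16 ≤ ell := by
    rw [hell]; exact le_trans (by linarith) (le_max_right _ _)
  have hpow : |1 - t ^ k| ≤ u * (k * 2 ^ k) := by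
    have h := abs_pow_sub_pow_le (1 : ℝ) t k
    rw [one_pow, abs_one, abs_of_pos ht0, abs_sub_comm 1 t] at h
    calc |1 - t ^ k| ≤ |t - 1| * k * max 1 t ^ (k - 1) := h
      _ ≤ u * k * 2 ^ k := by
          have : max 1 t ^ (k - 1) ≤ (2 : ℝ) ^ k :=
            (pow_le_pow_left₀ (by positivity) (max_le one_le_two ht2) _).trans
              (pow_le_pow_right₀ one_le_two (by omega))
          gcongr
      _ = u * (k * 2 ^ k) := by ring
  have hulam : u * lam ≤ 1 := by
    calc u * lam ≤ u * (1 / u - 1) := by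
          gcongr; exact Real.log_le_sub_one_of_pos (by positivity)
      _ = 1 - u := by field_simp
      _ ≤ 1 := by linarith
  have htk : t ^ k ≤ 2 ^ k := pow_le_pow_left₀ ht0.le ht2 k
  have hβk : β ^ k ≤ β := pow_le_of_le_one hβ.le hβ1 (by omega)
  have hmain : |(1 - t ^ k) * lam + t ^ k * (lam - ell)| ≤ k * 2 ^ k + 2 ^ k * Real.log 16 := by
    refine (abs_add_le _ _).trans (add_le_add ?_ ?_)
    · rw [abs_mul, abs_of_nonneg hlam]
      calc |1 - t ^ k| * lam ≤ u * (k * 2 ^ k) * lam := by gcongr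
        _ = (u * lam) * (k * 2 ^ k) := by ring
        _ ≤ 1 * (k * 2 ^ k) := by gcongr
        _ = k * 2 ^ k := one_mul _
    · rw [abs_mul, abs_of_pos (pow_pos ht0 k), abs_of_nonneg (sub_nonneg.2 hell1)]
      exact mul_le_mul htk (by linarith) (by linarith) (by positivity)
  have e : β ^ k * lam - (1 / (r.den : ℝ)) ^ k * ell
      = β ^ k * ((1 - t ^ k) * lam + t ^ k * (lam - ell)) := by
    rw [hqinv, mul_pow]; ring
  rw [e, abs_mul, abs_of_pos (pow_pos hβ k), mul_comm]
  exact mul_le_mul hmain hβk (by positivity) ((abs_nonneg _).trans hmain)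

/-- The Brjuno function differs from its arithmetic model by a bounded function: only convergents
contribute to the model, each exactly once. -/
lemma summable_brjunoTerm_and_abs_sub_le {k : ℕ} (hk : 1 ≤ k) {α : ℝ}
    (hα : α ∈ Set.Icc (1 / 2 : ℝ) 1) {x : ℝ} (hx : Irrational x)
    (hs : Summable fun r : ℚ => ratTerm k r x) :
    Summable (fun n => brjunoTerm k α n x) ∧
      |brjuno k α x - ratSum k x| ≤ 4 * termConst k := by
  choose c hc t ht ht1 ht2 ht3 using fun n => exists_convergent hα hx n
  have hterm := fun n => abs_brjunoTerm_sub_ratTerm_le hk hα hx n (hc n) (ht n) (ht1 n) (ht2 n)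
    (ht3 n)
  have hinj : Function.Injective c := by
    intro i j hij
    have h : betaPrev α (i + 1) x = betaPrev α (j + 1) x := by rw [← hc i, ← hc j, hij]
    have := (betaPrev_strictAnti hα hx).injective h
    omega
  have hsupp : Function.support (fun r : ℚ => ratTerm k r x) ⊆ Set.range c := by
    intro r hr
    refine exists_eq_convergent hα hx hc (fun n => ?_) (not_le.1 fun h => hr ?_)
    · have hnn : 0 ≤ betaPrev α n x * (c n).den :=
        mul_nonneg (betaPrev_nonneg hα n x) (Nat.cast_nonneg _)
      nlinarith [ht n, ht1 n]
    · simp only [ratTerm]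
      rw [logBump_eq_zero (radius_pos r) h, mul_zero]
  have hsc : Summable fun n => ratTerm k (c n) x := hs.comp_injective hinj
  have hβ := (summable_betaPrev hα hx).mul_left (termConst k)
  have hd : Summable fun n => brjunoTerm k α n x - ratTerm k (c n) x :=
    Summable.of_norm_bounded hβ hterm
  have hb : Summable fun n => brjunoTerm k α n x := by simpa using hd.add hsc
  refine ⟨hb, ?_⟩
  have hF : ratSum k x = ∑' n, ratTerm k (c n) x := (hinj.tsum_eq hsupp).symm
  rw [hF, brjuno, ← hb.tsum_sub hsc]
  rw [← Real.norm_eq_abs]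
  refine (tsum_of_norm_bounded hβ.hasSum hterm).trans ?_
  rw [tsum_mul_left, mul_comm]
  refine mul_le_mul_of_nonneg_right (tsum_betaPrev_le hα hx) ?_
  have := Real.log_pos (x := 16) (by norm_num)
  unfold termConst
  positivity

/-! ### Bounded mean oscillation -/

lemma measurable_orbit (α : ℝ) (n : ℕ) : Measurable (orbit α n) := by
  induction n with
  | zero =>
    have : orbit α 0 = fun x => |x - (⌊x - α + 1⌋ : ℤ)| := rfl
    rw [this]
    fun_prop
  | succ n ih =>
    have : orbit α (n + 1) = fun x => |1 / orbit α n x - (⌊1 / orbit α n x - α + 1⌋ : ℤ)| :=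
      funext fun x => orbit_succ α n x
    rw [this]
    fun_prop

lemma measurable_brjuno (k : ℕ) (α : ℝ) :
    Measurable (brjuno k α) := by
  have hterm : ∀ n, Measurable (brjunoTerm k α n) := fun n => by
    have h := measurable_orbit α
    unfold brjunoTerm betaPrev
    fun_prop
  exact Measurable.tsum hterm

/-- To bound mean oscillations it is enough to compare with some constant on each interval. -/
lemma memBMO_of_exists_const {f : ℝ → ℝ} (hf : Measurable f) {K : ℝ} (hK : 0 ≤ K)
    (h : ∀ a b : ℝ, a < b → ∃ c : ℝ,
      ∫⁻ x in Set.Ioc a b, ‖f x - c‖ₑ ≤ ENNReal.ofReal (K * (b - a))) :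
    MemBMO Set.univ f := by
  have hsub : ∀ a b c : ℝ, ∫⁻ x in Set.Ioc a b, ‖f x - c‖ₑ ≤ ENNReal.ofReal (K * (b - a)) →
      IntegrableOn (fun x => f x - c) (Set.Ioc a b) := fun a b c hc =>
    ⟨(hf.sub_const c).aestronglyMeasurable, hc.trans_lt ENNReal.ofReal_lt_top⟩
  have hint : ∀ a b c : ℝ, ∫⁻ x in Set.Ioc a b, ‖f x - c‖ₑ ≤ ENNReal.ofReal (K * (b - a)) →
      IntegrableOn f (Set.Ioc a b) := fun a b c hc => by
    have hconst : IntegrableOn (fun _ : ℝ => c) (Set.Ioc a b) :=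
      integrableOn_const (by simp) (by simp)
    exact ((hsub a b c hc).add hconst).congr (by filter_upwards with x; simp)
  refine ⟨fun x => ?_, ?_⟩
  · obtain ⟨c, hc⟩ := h (x - 1) (x + 1) (by linarith)
    exact ⟨Set.Ioc (x - 1) (x + 1), Ioc_mem_nhds (by linarith) (by linarith), hint _ _ c hc⟩
  refine lt_of_le_of_lt (b := ENNReal.ofReal (2 * K)) ?_ ENNReal.ofReal_lt_top
  refine iSup_le fun a => iSup_le fun b => iSup_le fun hab => iSup_le fun _ =>
    ENNReal.ofReal_le_ofReal ?_
  obtain ⟨c, hc⟩ := h a b hab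
  have hL : 0 < b - a := sub_pos.2 hab
  have hI : IntervalIntegrable f volume a b :=
    (intervalIntegrable_iff_integrableOn_Ioc_of_le hab.le).2 (hint a b c hc)
  have hIc : IntervalIntegrable (fun x => f x - c) volume a b :=
    (intervalIntegrable_iff_integrableOn_Ioc_of_le hab.le).2 (hsub a b c hc)
  have hbound : ∫ x in a..b, |f x - c| ≤ K * (b - a) := by
    rw [intervalIntegral.integral_of_le hab.le, ← ENNReal.ofReal_le_ofReal_iff (by positivity)]
    exact (ofReal_integral_norm_eq_lintegral_enorm (hsub a b c hc)).trans_le hc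
  unfold meanOsc
  set A := 1 / (b - a) * ∫ y in a..b, f y with hA
  have hcA : (b - a) * |c - A| ≤ K * (b - a) := by
    have e : ∫ x in a..b, (f x - c) = (b - a) * (A - c) := by
      rw [intervalIntegral.integral_sub hI (by simp), intervalIntegral.integral_const, hA,
        smul_eq_mul]
      field_simp
    calc (b - a) * |c - A| = |∫ x in a..b, (f x - c)| := by
          rw [e, abs_mul, abs_of_pos hL, abs_sub_comm]
      _ ≤ ∫ x in a..b, |f x - c| := intervalIntegral.abs_integral_le_integral_abs hab.le
      _ ≤ _ := hbound
  have hmono : ∫ x in a..b, |f x - A| ≤ ∫ x in a..b, (|f x - c| + |c - A|) := by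
    refine intervalIntegral.integral_mono_on hab.le ?_ ?_ fun x _ => abs_sub_le _ _ _
    · exact (hI.sub (by simp)).abs
    · exact hIc.abs.add (by simp)
  rw [intervalIntegral.integral_add hIc.abs (by simp), intervalIntegral.integral_const,
    smul_eq_mul] at hmono
  rw [one_div, inv_mul_le_iff₀ hL]
  linarith

end KBrjuno

theorem mainTheorem3 (k : ℕ) (hk : 1 ≤ k) (α : ℝ) (hα : α ∈ Set.Icc (1 / 2 : ℝ) 1) :
    (∀ᵐ x : ℝ, Summable fun n : ℕ => KBrjuno.brjunoTerm k α n x) ∧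
      KBrjuno.MemBMO Set.univ (KBrjuno.brjuno k α) := by
  have hirr : ∀ᵐ x : ℝ, Irrational x :=
    measure_eq_zero_iff_ae_notMem.1 ((Set.countable_range ((↑) : ℚ → ℝ)).measure_zero volume)
  have hcomp : ∀ᵐ x : ℝ, Summable (fun n : ℕ => KBrjuno.brjunoTerm k α n x) ∧
      |KBrjuno.brjuno k α x - KBrjuno.ratSum k x| ≤ 4 * KBrjuno.termConst k := by
    filter_upwards [hirr, KBrjuno.ae_summable_ratTerm hk] with x hx hs
    exact KBrjuno.summable_brjunoTerm_and_abs_sub_le hk hα hx hs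
  have hC : 0 ≤ 4 * KBrjuno.termConst k := by
    obtain ⟨x, hx⟩ := hcomp.exists
    exact (abs_nonneg _).trans hx.2
  refine ⟨hcomp.mono fun x hx => hx.1,
    KBrjuno.memBMO_of_exists_const (KBrjuno.measurable_brjuno k α)
      (K := 20 + 4 * KBrjuno.termConst k) (by linarith) fun a b hab => ?_⟩
  obtain ⟨c, hc⟩ := KBrjuno.exists_lintegral_ratSum_sub_le hk hab
  refine ⟨c, ?_⟩
  have hL : 0 < b - a := sub_pos.2 hab
  calc ∫⁻ x in Set.Ioc a b, ‖KBrjuno.brjuno k α x - c‖ₑ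
      ≤ ∫⁻ x in Set.Ioc a b,
          (‖KBrjuno.ratSum k x - c‖ₑ + ENNReal.ofReal (4 * KBrjuno.termConst k)) := by
        refine lintegral_mono_ae (ae_restrict_of_ae ?_)
        filter_upwards [hcomp] with x hx
        calc ‖KBrjuno.brjuno k α x - c‖ₑ
            = ‖(KBrjuno.ratSum k x - c) + (KBrjuno.brjuno k α x - KBrjuno.ratSum k x)‖ₑ := by
              congr 1; ring
          _ ≤ _ := enorm_add_le _ _
          _ ≤ _ := by
              gcongr
              rw [Real.enorm_eq_ofReal_abs]
              exact ENNReal.ofReal_le_ofReal hx.2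
    _ = (∫⁻ x in Set.Ioc a b, ‖KBrjuno.ratSum k x - c‖ₑ)
          + ENNReal.ofReal (4 * KBrjuno.termConst k) * ENNReal.ofReal (b - a) := by
        rw [lintegral_add_right _ measurable_const, setLIntegral_const, Real.volume_Ioc]
    _ ≤ ENNReal.ofReal (20 * (b - a)) + ENNReal.ofReal (4 * KBrjuno.termConst k * (b - a)) := by
        rw [← ENNReal.ofReal_mul hC]
        gcongr
    _ = ENNReal.ofReal ((20 + 4 * KBrjuno.termConst k) * (b - a)) := by
        rw [← ENNReal.ofReal_add (by positivity) (by positivity)]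
        congr 1; ring
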